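/- Let $\mathbf{LG}$ be the category whose objects are triples $(G,\mathcal H,J)$ with $G$ a compact (Hausdorff) abelian group, $\mathcal H$ a real Hilbert space and $J:\widehat G\to\mathcal H^*$ a homomorphism of abelian groups, where $\widehat G$ is the group of continuous characters $G\to U(1)$ and $\mathcal H^*$ is the space of continuous linear functionals on $\mathcal H$. A morphism $(G_1,\mathcal H_1,J_1)\to(G_2,\mathcal H_2,J_2)$ is a pair $(\Psi,\Phi)$ of a continuous group homomorphism $\Psi:G_1\to G_2$ and a linear contraction $\Phi:\mathcal H_1\to\mathcal H_2$ (that is, $\|\Phi\|\le 1$) such that $\Phi^*\circ J_2=J_1\circ\Psi^*$, where $\Psi^*(\chi)=\chi\circ\Psi$ and $\Phi^*(\xi)=\xi\circ\Phi$; composition is componentwise. Let $\mathbf{TopG}_c$ be the category of compact (Hausdorff) topological groups and continuous homomorphisms, $\mathbf{Hilb}_1$ the category of real Hilbert spaces and linear contractions, and $\mathbf{AbG}$ the category of abelian groups. **Proposition.** The category $\mathbf{LG}$ has projective limits: every projective system $((G_i,\mathcal H_i,J_i),(\Psi_{ij},\Phi_{ij}))$ in $\mathbf{LG}$ indexed by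 a nonempty directed set $I$ has a limit. More precisely: 1. the system $(G_i,\Psi_{ij})$ has a limit in $\mathbf{TopG}_c$ that is an abelian group, and $(\mathcal H_i,\Phi_{ij})$ has a limit in $\mathbf{Hilb}_1$; 2. if $G_\infty$, with projections $\pi_i:G_\infty\to G_i$, is an abelian group that is a limit of $(G_i,\Psi_{ij})$ in $\mathbf{TopG}_c$, and $\mathcal H_\infty$, with projections $p_i:\mathcal H_\infty\to\mathcal H_i$, is a limit of $(\mathcal H_i,\Phi_{ij})$ in $\mathbf{Hilb}_1$, then $\widehat{G_\infty}$ with the maps $\pi_i^*:\widehat{G_i}\to\widehat{G_\infty}$ is an inductive limit of $(\widehat{G_i},\Psi_{ij}^*)$ in $\mathbf{AbG}$, and the triple $(G_\infty,\mathcal H_\infty,J_\infty)$ with the projections $(\pi_i,p_i)$ is a limit of the given system in $\mathbf{LG}$, where $J_\infty:\widehat{G_\infty}\to(\mathcal H_\infty)^*$ is the homomorphism induced by the $J_i$, i.e. the unique one with $J_\infty\circ\pi_i^*=p_i^*\circ J_i$ for all $i\in I$. -/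

import Mathlib

open CategoryTheory CategoryTheory.Limits Opposite

universe v u

/-! ### Compact (Hausdorff) topological groups -/

/-- A compact Hausdorff topological group, not necessarily abelian. -/
structure CompactGrp where
  carrier : Type u
  [group : Group carrier]
  [topologicalSpace : TopologicalSpace carrier]
  [isTopologicalGroup : IsTopologicalGroup carrier]
  [compactSpace : CompactSpace carrier]
  [t2Space : T2Space carrier]

namespace CompactGrp

instance : CoeSort CompactGrp.{u} (Type u) := ⟨CompactGrp.carrier⟩

attribute [instance] group topologicalSpace isTopologicalGroup compactSpace t2Space

/-- Morphisms of compact groups: continuous group homomorphisms. -/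
@[ext]
structure Hom (X Y : CompactGrp.{u}) where
  hom : X →ₜ* Y

instance : Category CompactGrp.{u} where
  Hom X Y := Hom X Y
  id X := ⟨ContinuousMonoidHom.id X⟩
  comp f g := ⟨g.hom.comp f.hom⟩

end CompactGrp

/-- A compact Hausdorff abelian topological group. -/
structure CompactAbGrp where
  carrier : Type u
  [commGroup : CommGroup carrier]
  [topologicalSpace : TopologicalSpace carrier]
  [isTopologicalGroup : IsTopologicalGroup carrier]
  [compactSpace : CompactSpace carrier]
  [t2Space : T2Space carrier]

namespace CompactAbGrp

instance : CoeSort CompactAbGrp.{u} (Type u) := ⟨CompactAbGrp.carrier⟩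

attribute [instance] commGroup topologicalSpace isTopologicalGroup compactSpace t2Space

/-- Morphisms of compact abelian groups: continuous group homomorphisms. -/
@[ext]
structure Hom (X Y : CompactAbGrp.{u}) where
  hom : X →ₜ* Y

instance : Category CompactAbGrp.{u} where
  Hom X Y := Hom X Y
  id X := ⟨ContinuousMonoidHom.id X⟩
  comp f g := ⟨g.hom.comp f.hom⟩

/-- The (fully faithful) inclusion of compact abelian groups into compact groups. -/
def toCompactGrp : CompactAbGrp.{u} ⥤ CompactGrp.{u} where
  obj X := ⟨X⟩
  map f := ⟨f.hom⟩

/-- The dual map `χ ↦ χ ∘ f` on character groups (written additively). -/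
noncomputable def dualHom {X Y : CompactAbGrp.{u}} (f : X ⟶ Y) :
    Additive (PontryaginDual Y) →+ Additive (PontryaginDual X) :=
  MonoidHom.toAdditive (PontryaginDual.map f.hom).toMonoidHom

/-- The character group as a contravariant functor to abelian groups. -/
noncomputable def dual : CompactAbGrp.{u}ᵒᵖ ⥤ AddCommGrpCat.{u} where
  obj X := AddCommGrpCat.of (Additive (PontryaginDual X.unop))
  map f := AddCommGrpCat.ofHom (dualHom f.unop)

end CompactAbGrp

/-! ### Real Hilbert spaces and linear contractions -/

/-- A real Hilbert space. -/
structure HilbOne where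
  carrier : Type u
  [normedAddCommGroup : NormedAddCommGroup carrier]
  [innerProductSpace : InnerProductSpace ℝ carrier]
  [completeSpace : CompleteSpace carrier]

namespace HilbOne

instance : CoeSort HilbOne.{u} (Type u) := ⟨HilbOne.carrier⟩

attribute [instance] normedAddCommGroup innerProductSpace completeSpace

/-- Morphisms of Hilbert spaces: linear contractions. -/
@[ext]
structure Hom (X Y : HilbOne.{u}) where
  hom : X →L[ℝ] Y
  norm_le_one : ‖hom‖ ≤ 1

instance : Category HilbOne.{u} where
  Hom X Y := Hom X Y
  id X := ⟨ContinuousLinearMap.id ℝ X, ContinuousLinearMap.norm_id_le⟩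
  comp f g := ⟨g.hom.comp f.hom, (g.hom.opNorm_comp_le f.hom).trans
    (mul_le_one₀ g.norm_le_one (norm_nonneg _) f.norm_le_one)⟩

/-- The dual map `ξ ↦ ξ ∘ f` on spaces of continuous linear functionals. -/
def dualHom {X Y : HilbOne.{u}} (f : X ⟶ Y) :
    StrongDual ℝ Y →+ StrongDual ℝ X where
  toFun ξ := ξ.comp f.hom
  map_zero' := ContinuousLinearMap.zero_comp _
  map_add' ξ η := ContinuousLinearMap.add_comp ξ η _

end HilbOne

/-! ### The category of triples -/

/-- A triple `(G, H, J)`: a compact abelian group, a real Hilbert space, and a homomorphism of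
abelian groups from the character group of `G` to the dual space of `H`. -/
structure LG where
  G : CompactAbGrp.{u}
  H : HilbOne.{u}
  J : Additive (PontryaginDual G) →+ StrongDual ℝ H

namespace LG

/-- A morphism of triples: a pair `(Ψ, Φ)` with `Φ* ∘ J₂ = J₁ ∘ Ψ*`. -/
@[ext]
structure Hom (X Y : LG.{u}) where
  Ψ : X.G ⟶ Y.G
  Φ : X.H ⟶ Y.H
  compat : (HilbOne.dualHom Φ).comp Y.J = X.J.comp (CompactAbGrp.dualHom Ψ)

instance : Category LG.{u} where
  Hom X Y := Hom X Y
  id X := ⟨𝟙 X.G, 𝟙 X.H, rfl⟩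
  comp {X Y Z} f g := ⟨f.Ψ ≫ g.Ψ, f.Φ ≫ g.Φ, by
    refine AddMonoidHom.ext fun χ => ?_
    have hg := DFunLike.congr_fun g.compat χ
    have hf := DFunLike.congr_fun f.compat (CompactAbGrp.dualHom g.Ψ χ)
    exact (congrArg (HilbOne.dualHom f.Φ) hg).trans hf⟩

/-- The functor `(G, H, J) ↦ G`. -/
def toCompactAbGrp : LG.{u} ⥤ CompactAbGrp.{u} where
  obj X := X.G
  map f := f.Ψ

/-- The functor `(G, H, J) ↦ H`. -/
def toHilbOne : LG.{u} ⥤ HilbOne.{u} where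
  obj X := X.H
  map f := f.Φ

variable {I : Type v} [Preorder I]

/-- For a projective system of triples, a cone `cG` over the groups and a cone `cH` over the Hilbert
spaces, the dual maps of the projections of `cH`, composed with the `J i`, form a cocone over the
inductive system of character groups, whose vertex is the dual space of `cH.pt`. -/
noncomputable def dualCocone (F : Iᵒᵖ ⥤ LG.{u}) (cH : Cone (F ⋙ toHilbOne)) :
    Cocone ((F ⋙ toCompactAbGrp).op ⋙ CompactAbGrp.dual) where
  pt := AddCommGrpCat.of (StrongDual ℝ cH.pt)
  ι :=
    { app := fun i => AddCommGrpCat.ofHom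
        ((HilbOne.dualHom (cH.π.app i.unop)).comp (F.obj i.unop).J)
      naturality := fun i j f => by
        ext χ : 2
        have h1 := DFunLike.congr_fun (F.map f.unop).compat χ
        have h2 := cH.w f.unop
        have h3 : HilbOne.dualHom (cH.π.app i.unop)
            = (HilbOne.dualHom (cH.π.app j.unop)).comp
              (HilbOne.dualHom (F.map f.unop).Φ) := by
          rw [← h2]; rfl
        change (HilbOne.dualHom (cH.π.app j.unop)) ((F.obj j.unop).J
          (CompactAbGrp.dualHom (F.map f.unop).Ψ χ))
          = HilbOne.dualHom (cH.π.app i.unop) ((F.obj i.unop).J χ)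
        rw [h3]
        exact (congrArg (HilbOne.dualHom (cH.π.app j.unop)) h1).symm }

/-- The homomorphism from the character group of `cG.pt` to the dual space of `cH.pt` induced by the
`J i`, when the character group of `cG.pt` is the inductive limit of the character groups. -/
noncomputable def inducedJ (F : Iᵒᵖ ⥤ LG.{u}) (cG : Cone (F ⋙ toCompactAbGrp))
    (cH : Cone (F ⋙ toHilbOne)) (hD : IsColimit (CompactAbGrp.dual.mapCocone cG.op)) :
    Additive (PontryaginDual cG.pt) →+ StrongDual ℝ cH.pt :=
  (hD.desc (dualCocone F cH)).hom

/-- The cone over a projective system of triples with vertex `(cG.pt, cH.pt, inducedJ)` and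
with the projections of `cG` and `cH`. -/
noncomputable def inducedCone (F : Iᵒᵖ ⥤ LG.{u}) (cG : Cone (F ⋙ toCompactAbGrp))
    (cH : Cone (F ⋙ toHilbOne)) (hD : IsColimit (CompactAbGrp.dual.mapCocone cG.op)) :
    Cone F where
  pt := ⟨cG.pt, cH.pt, inducedJ F cG cH hD⟩
  π :=
    { app := fun i => ⟨cG.π.app i, cH.π.app i,
        (congrArg AddCommGrpCat.Hom.hom (hD.fac (dualCocone F cH) (op i))).symm⟩
      naturality := fun _ _ f => LG.Hom.ext (cG.π.naturality f) (cH.π.naturality f) }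

end LG

/-! ### Characters close to each other and approximate characters -/

/-! Limits of groups are compatible families in the product, and limits of Hilbert spaces are
bounded compatible families with the sup norm. Along a directed set that norm is a limit of
increasing norms, so the parallelogram law survives.

The substance is that the characters of the limit `c.pt` are the inductive limit of those of the
`F.obj i`, although projections need not be surjective and Pontryagin duality is not used. Two
homomorphisms to the circle that stay within 1/2 of each other coincide. Injectivity
(`exists_character_map_eq`): characters agreeing on the image of `c.pt` are close near it, hence on
the image of some later group by compactness, hence equal there. Surjectivity
(`exists_character_proj_eq`): a character of `c.pt` descends to its closed image at some stage,
extends by Tietze to a function that is almost multiplicative near that image, and Hyers' correction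
(`exists_character_near`) turns its pullback to a later stage into a character. The map induced by
the `J i` then exists by the colimit property, and the triple is a limit componentwise. -/

namespace Circle

/-- Since `w ^ 2 - 1 = (w + 1) * (w - 1)` and `‖w + 1‖ ≥ 3 / 2` near 1, each squaring multiplies the
distance to 1 by at least 3/2. -/
theorem eq_one_of_forall_norm_pow_two_pow_sub_one_le {z : Circle}
    (h : ∀ n : ℕ, ‖((z ^ (2 ^ n) : Circle) : ℂ) - 1‖ ≤ 1 / 2) : z = 1 := by
  have key : ∀ n : ℕ, (3 / 2 : ℝ) ^ n * ‖(z : ℂ) - 1‖ ≤ ‖((z ^ (2 ^ n) : Circle) : ℂ) - 1‖ := by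
    intro n
    induction n with
    | zero => simp
    | succ n ih =>
      set w : ℂ := ((z ^ (2 ^ n) : Circle) : ℂ) with hw
      have hw' : ((z ^ (2 ^ (n + 1)) : Circle) : ℂ) - 1 = (w + 1) * (w - 1) := by
        rw [pow_succ, pow_mul, coe_pow, ← hw]; ring
      have h1 : (3 / 2 : ℝ) ≤ ‖w + 1‖ := by
        have h2 : ‖(2 : ℂ)‖ ≤ ‖w + 1‖ + ‖w - 1‖ := by
          calc ‖(2 : ℂ)‖ = ‖(w + 1) - (w - 1)‖ := by ring_nf
            _ ≤ _ := norm_sub_le _ _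
        have := h n
        rw [← hw] at this
        norm_num at h2 this
        linarith
      rw [hw', norm_mul, pow_succ, mul_right_comm, mul_comm]
      gcongr
  by_contra hz
  have hpos : 0 < ‖(z : ℂ) - 1‖ := norm_pos_iff.2 (sub_ne_zero.2 fun e => hz (coe_eq_one.1 e))
  obtain ⟨n, hn⟩ := pow_unbounded_of_one_lt (1 / 2 / ‖(z : ℂ) - 1‖) (by norm_num : (1 : ℝ) < 3 / 2)
  rw [div_lt_iff₀ hpos] at hn
  exact absurd (hn.trans_le (key n)) (not_lt.2 (h n))

theorem norm_div_sub_one (z w : Circle) : ‖((z / w : Circle) : ℂ) - 1‖ = ‖(z : ℂ) - w‖ := by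
  rw [coe_div, div_sub_one w.coe_ne_zero, norm_div, norm_coe, div_one]

theorem norm_exp_sub_one_le (t : ℝ) : ‖(exp t : ℂ) - 1‖ ≤ |t| := by
  rw [coe_exp, mul_comm]
  exact Real.norm_exp_I_mul_ofReal_sub_one_le

theorem abs_arg_le_of_norm_sub_one_le {z : Circle} (hz : ‖(z : ℂ) - 1‖ ≤ 1 / 2) :
    |Complex.arg z| ≤ 3 / 2 * ‖(z : ℂ) - 1‖ := by
  have h := Complex.norm_log_one_add_half_le_self hz
  rw [add_sub_cancel] at h
  refine le_trans ?_ h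
  rw [← Complex.log_im]
  exact Complex.abs_im_le_norm _

end Circle

theorem MonoidHom.eq_of_forall_norm_circle_sub_le {G : Type*} [Group G] {f g : G →* Circle}
    (h : ∀ x, ‖(f x : ℂ) - g x‖ ≤ 1 / 2) : f = g := by
  ext1 x
  refine div_eq_one.1 (Circle.eq_one_of_forall_norm_pow_two_pow_sub_one_le fun n => ?_)
  rw [div_pow, ← map_pow, ← map_pow, Circle.norm_div_sub_one]
  exact h _

/-- Hyers' theorem for the circle: an approximate character is close to a character. -/
theorem exists_character_near {G : Type*} [CommGroup G] [TopologicalSpace G] [IsTopologicalGroup G]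
    (u : C(G, Circle)) (hu : ∀ x y, ‖(u (x * y) : ℂ) - u x * u y‖ ≤ 1 / 16) :
    ∃ χ : G →ₜ* Circle, ∀ x, ‖(χ x : ℂ) - u x‖ ≤ 3 / 32 := by
  have hq : ∀ x, ‖((u (x ^ 2) / u x ^ 2 : Circle) : ℂ) - 1‖ ≤ 1 / 16 := fun x => by
    rw [Circle.norm_div_sub_one]; simpa [sq] using hu x x
  -- `b` is the angle by which `u` fails to respect squaring; the ratio stays near 1, so the
  -- principal argument is continuous there. The bound 3/32 is 3/2 · 1/16.
  let b : G → ℝ := fun x => Complex.arg ((u (x ^ 2) / u x ^ 2 : Circle) : ℂ)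
  have hb : ∀ x, |b x| ≤ 3 / 32 := fun x =>
    (Circle.abs_arg_le_of_norm_sub_one_le ((hq x).trans (by norm_num))).trans
      (by linarith [hq x])
  have hbc : Continuous b := by
    have hc' : Continuous fun x => u (x ^ 2) / u x ^ 2 := by fun_prop
    have hc : Continuous fun x => ((u (x ^ 2) / u x ^ 2 : Circle) : ℂ) :=
      (by fun_prop : Continuous ((↑) : Circle → ℂ)).comp hc'
    refine continuous_iff_continuousAt.2 fun x => ContinuousAt.comp (f := fun x =>
      ((u (x ^ 2) / u x ^ 2 : Circle) : ℂ)) (Complex.continuousAt_arg ?_) hc.continuousAt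
    rw [← add_sub_cancel (1 : ℂ) ((u (x ^ 2) / u x ^ 2 : Circle) : ℂ)]
    exact Complex.mem_slitPlane_of_norm_lt_one ((hq x).trans_lt (by norm_num))
  -- The series `∑ b (x ^ 2 ^ n) / 2 ^ (n + 1)` solves `2 * β x = b x + β (x ^ 2)`, which makes `u *
  -- exp β` commute exactly with squaring.
  let t : ℕ → G → ℝ := fun n x => b (x ^ (2 ^ n)) * (1 / 2) ^ n / 2
  have hsum : Summable fun n : ℕ => 3 / 32 * (1 / 2 : ℝ) ^ n / 2 :=
    (summable_geometric_two.mul_left _).div_const _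
  have ht : ∀ n x, ‖t n x‖ ≤ 3 / 32 * (1 / 2 : ℝ) ^ n / 2 := fun n x => by
    simp only [t, Real.norm_eq_abs, abs_div, abs_mul, abs_pow, abs_two, abs_one]
    gcongr
    exact hb _
  let β : G → ℝ := fun x => ∑' n, t n x
  have hβc : Continuous β := continuous_tsum (fun n => by fun_prop) hsum ht
  have hβ : ∀ x, |β x| ≤ 3 / 32 := fun x => by
    refine (tsum_of_norm_bounded hsum.hasSum fun n => ht n x).trans (le_of_eq ?_)
    rw [tsum_div_const, tsum_mul_left, tsum_geometric_two]
    norm_num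
  have hβ2 : ∀ x, 2 * β x = b x + β (x ^ 2) := fun x => by
    have hs : ∀ x, Summable fun n => t n x := fun x => .of_norm_bounded hsum fun n => ht n x
    have e : ∀ n, t (n + 1) x = t n (x ^ 2) / 2 := fun n => by
      simp only [t]
      rw [← pow_mul x 2, ← pow_succ' 2 n, pow_succ (1 / 2 : ℝ)]
      ring
    have := (hs x).tsum_eq_zero_add
    simp only [e, tsum_div_const] at this
    simp only [β, this, t]
    simp
    ring
  obtain ⟨h, hdef⟩ : ∃ h : G → Circle, ∀ x, h x = u x * Circle.exp (β x) := ⟨_, fun _ => rfl⟩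
  have hh2 : ∀ x, h (x ^ 2) = h x ^ 2 := fun x => by
    have e : Circle.exp (b x) = u (x ^ 2) / u x ^ 2 := Circle.exp_arg _
    rw [hdef, hdef, mul_pow, ← Circle.exp_nsmul, nsmul_eq_mul, Nat.cast_two, hβ2, Circle.exp_add, e,
      ← mul_assoc, mul_div_cancel]
  have hhu : ∀ x, ‖(h x : ℂ) - u x‖ ≤ 3 / 32 := fun x => by
    have : (h x : ℂ) - u x = u x * ((Circle.exp (β x) : ℂ) - 1) := by
      rw [hdef, Circle.coe_mul]; ring
    rw [this, norm_mul, Circle.norm_coe, one_mul]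
    exact (Circle.norm_exp_sub_one_le _).trans (hβ x)
  -- Three errors of 3/32 and one of 1/16 add up to 11/32.
  have hD : ∀ x y, ‖(h (x * y) : ℂ) - h x * h y‖ ≤ 1 / 2 := fun x y => by
    have e : (h (x * y) : ℂ) - h x * h y = (h (x * y) - u (x * y)) + (u (x * y) - u x * u y)
        - ((h x - u x) * h y + u x * (h y - u y)) := by ring
    rw [e]
    refine (norm_sub_le _ _).trans ?_
    have h1 := norm_add_le ((h (x * y) : ℂ) - u (x * y)) (u (x * y) - u x * u y)
    have h2 := norm_add_le (((h x : ℂ) - u x) * h y) (u x * (h y - u y))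
    rw [norm_mul, norm_mul, Circle.norm_coe, Circle.norm_coe] at h2
    linarith [hhu (x * y), hhu x, hhu y, hu x y]
  have hpow : ∀ (n : ℕ) x, h (x ^ (2 ^ n)) = h x ^ (2 ^ n) := fun n x => by
    induction n with
    | zero => simp
    | succ n ih => rw [pow_succ, pow_mul, hh2, ih, ← pow_mul]
  -- The `2 ^ n`-th power of the defect at `(x, y)` is the defect at `(x ^ 2 ^ n, y ^ 2 ^ n)`, by
  -- commutativity of `G`, so all these powers remain near 1.
  have hmul : ∀ x y, h (x * y) = h x * h y := fun x y => by
    refine div_eq_one.1 (Circle.eq_one_of_forall_norm_pow_two_pow_sub_one_le fun n => ?_)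
    rw [div_pow, mul_pow (h x), ← hpow, ← hpow, ← hpow, mul_pow x y, Circle.norm_div_sub_one]
    simpa using hD (x ^ (2 ^ n)) (y ^ (2 ^ n))
  exact ⟨⟨MonoidHom.mk' h hmul, by
    change Continuous h
    rw [funext hdef]
    fun_prop⟩, hhu⟩

/-! ### Limits of compact abelian groups -/

instance : CompactAbGrp.toCompactGrp.{u}.Full where
  map_surjective f := ⟨⟨f.hom⟩, rfl⟩

instance : CompactAbGrp.toCompactGrp.{u}.Faithful where
  map_injective h := CompactAbGrp.Hom.ext (congrArg CompactGrp.Hom.hom h)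

namespace CompactAbGrp

variable {J : Type v} [Category.{v} J] (F : J ⥤ CompactAbGrp.{max v u})

/-- The group of compatible families of elements of a diagram of compact abelian groups. -/
def threads : Subgroup (∀ j, F.obj j) where
  carrier := {x | ∀ ⦃i j⦄ (f : i ⟶ j), (F.map f).hom (x i) = x j}
  mul_mem' hx hy i j f := by simp [hx f, hy f]
  one_mem' i j f := map_one _
  inv_mem' hx i j f := by simp [hx f]

theorem isClosed_threads : IsClosed (threads F : Set (∀ j, F.obj j)) := by
  have : (threads F : Set (∀ j, F.obj j)) =
      ⋂ (i) (j) (f : i ⟶ j), {x | (F.map f).hom (x i) = x j} := by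
    ext x; simp [threads]
  rw [this]
  exact isClosed_iInter fun i => isClosed_iInter fun j => isClosed_iInter fun f =>
    isClosed_eq ((map_continuous (F.map f).hom).comp (continuous_apply i)) (continuous_apply j)

/-- The cone of compatible families. -/
def limitCone : Cone F where
  pt :=
    haveI : CompactSpace (threads F) := isCompact_iff_compactSpace.1 (isClosed_threads F).isCompact
    ⟨threads F⟩
  π :=
    { app := fun j => ⟨⟨(Pi.evalMonoidHom _ j).comp (threads F).subtype,
        (continuous_apply j).comp continuous_subtype_val⟩⟩
      naturality := fun _ _ f => CompactAbGrp.Hom.ext <| ContinuousMonoidHom.ext fun x =>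
        (x.2 f).symm }

/-- The cone of compatible families is a limit among all compact groups. -/
def isLimitMapConeLimitCone : IsLimit (toCompactGrp.mapCone (limitCone F)) where
  lift s := ⟨⟨⟨⟨fun x => ⟨fun j => (s.π.app j).hom x, fun _ _ f =>
      DFunLike.congr_fun (congrArg CompactGrp.Hom.hom (s.w f)) x⟩,
      Subtype.ext (funext fun j => map_one (s.π.app j).hom)⟩,
      fun x y => Subtype.ext (funext fun j => map_mul (s.π.app j).hom x y)⟩,
      Continuous.subtype_mk (continuous_pi fun j => map_continuous (s.π.app j).hom) _⟩⟩
  fac _ _ := rfl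
  uniq _ _ h := CompactGrp.Hom.ext <| ContinuousMonoidHom.ext fun x =>
    Subtype.ext <| funext fun j =>
      DFunLike.congr_fun (congrArg CompactGrp.Hom.hom (h j)) x

/-- The cone of compatible families is a limit cone. -/
noncomputable def isLimitLimitCone : IsLimit (limitCone F) :=
  isLimitOfReflects toCompactGrp (isLimitMapConeLimitCone F)

variable {F}

/-- The projection of the vertex of a cone to a member of the diagram. -/
def proj (c : Cone F) (j : J) : c.pt →ₜ* F.obj j := (c.π.app j).hom

theorem eq_one_of_forall_π_eq_one {c : Cone F} (hc : IsLimit c) {x : c.pt}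
    (hx : ∀ j, proj c j x = 1) : x = 1 := by
  let e := hc.conePointUniqueUpToIso (isLimitLimitCone F)
  have h1 : e.hom.hom x = 1 := Subtype.ext <| funext fun j => by
    have := hc.conePointUniqueUpToIso_hom_comp (isLimitLimitCone F) j
    exact (DFunLike.congr_fun (congrArg CompactAbGrp.Hom.hom this) x).trans (hx j)
  have h2 : e.inv.hom (e.hom.hom x) = x :=
    DFunLike.congr_fun (congrArg CompactAbGrp.Hom.hom e.hom_inv_id) x
  rw [← h2, h1, map_one]

theorem exists_forall_π_eq {c : Cone F} (hc : IsLimit c) {t : ∀ j, F.obj j} (ht : t ∈ threads F) :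
    ∃ x : c.pt, ∀ j, proj c j x = t j := by
  let e := hc.conePointUniqueUpToIso (isLimitLimitCone F)
  refine ⟨e.inv.hom (⟨t, ht⟩ : threads F), fun j => ?_⟩
  have := hc.conePointUniqueUpToIso_inv_comp (isLimitLimitCone F) j
  exact DFunLike.congr_fun (congrArg CompactAbGrp.Hom.hom this) (⟨t, ht⟩ : threads F)

end CompactAbGrp

/-! ### Projective limits of Hilbert spaces -/

namespace HilbOne

theorem norm_hom_apply_le {X Y : HilbOne.{u}} (f : X ⟶ Y) (x : X) : ‖f.hom x‖ ≤ ‖x‖ :=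
  (f.hom.le_of_opNorm_le f.norm_le_one x).trans_eq (one_mul _)

section

variable {J : Type v} [Category.{v} J] (F : J ⥤ HilbOne.{max v u})

/-- The space of bounded compatible families of vectors of a diagram of Hilbert spaces. -/
def boundedThreads : Submodule ℝ (lp (fun j => (F.obj j : Type (max v u))) ⊤) where
  carrier := {x | ∀ ⦃i j⦄ (f : i ⟶ j), (F.map f).hom (x i) = x j}
  add_mem' hx hy i j f := by simp [hx f, hy f]
  zero_mem' i j f := map_zero _
  smul_mem' r x hx i j f := by simp [hx f]

theorem isClosed_boundedThreads :
    IsClosed (boundedThreads F : Set (lp (fun j => (F.obj j : Type (max v u))) ⊤)) := by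
  have : (boundedThreads F : Set (lp (fun j => (F.obj j : Type (max v u))) ⊤)) =
      ⋂ (i) (j) (f : i ⟶ j), {x | (F.map f).hom (x i) = x j} := by
    ext x; simp only [Set.mem_iInter]; rfl
  have hc : ∀ j, Continuous fun x : lp (fun j => (F.obj j : Type (max v u))) ⊤ => x j := fun j =>
    (continuous_apply j).comp (lp.uniformContinuous_coe).continuous
  rw [this]
  exact isClosed_iInter fun i => isClosed_iInter fun j => isClosed_iInter fun f =>
    isClosed_eq ((F.map f).hom.continuous.comp (hc i)) (hc j)

end

variable {I : Type v} [Preorder I]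
  (F : Iᵒᵖ ⥤ HilbOne.{max v u})

-- Transition maps are contractions, so the norms increase along `I` and their supremum is a limit;
-- quadratic identities pass to limits, not to suprema.
open Filter Topology in
theorem tendsto_norm_boundedThreads (x : boundedThreads F) :
    Tendsto (fun i => ‖x.1 (op i)‖) atTop (𝓝 ‖x‖) := by
  have hm : Monotone fun i => ‖x.1 (op i)‖ := fun i j h => by
    change ‖x.1 (op i)‖ ≤ ‖x.1 (op j)‖
    rw [← x.2 (homOfLE h).op]
    exact norm_hom_apply_le _ _
  have hb : BddAbove (Set.range fun i => ‖x.1 (op i)‖) :=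
    ⟨‖x‖, by rintro _ ⟨i, rfl⟩; exact lp.norm_apply_le_norm (by simp) x.1 _⟩
  convert tendsto_atTop_ciSup hm hb using 2
  rw [Submodule.coe_norm, lp.norm_eq_ciSup]
  exact (Equiv.iSup_comp (g := fun i => ‖x.1 i‖) equivToOpposite).symm

variable [IsDirectedOrder I] [Nonempty I]

theorem boundedThreads_parallelogram (x y : boundedThreads F) :
    ‖x + y‖ * ‖x + y‖ + ‖x - y‖ * ‖x - y‖ = 2 * (‖x‖ * ‖x‖ + ‖y‖ * ‖y‖) := by
  have h := tendsto_norm_boundedThreads F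
  refine tendsto_nhds_unique (((h (x + y)).mul (h (x + y))).add ((h (x - y)).mul (h (x - y))))
    (((((h x).mul (h x)).add ((h y).mul (h y))).const_mul 2).congr fun i => ?_)
  have := parallelogram_law_with_norm ℝ (x.1 (op i)) (y.1 (op i))
  simp only [sq] at this
  exact this.symm

/-- The Hilbert space of bounded compatible families. -/
noncomputable def limitPt : HilbOne.{max v u} :=
  haveI : CompleteSpace (boundedThreads F) := (isClosed_boundedThreads F).completeSpace_coe
  letI : InnerProductSpace ℝ (boundedThreads F) :=
    InnerProductSpace.ofNorm ℝ (boundedThreads_parallelogram F)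
  ⟨boundedThreads F⟩

/-- The cone of bounded compatible families. -/
noncomputable def limitCone : Cone F where
  pt := limitPt F
  π :=
    { app := fun j =>
        { hom := LinearMap.mkContinuous
            { toFun := fun x : boundedThreads F => x.1 j
              map_add' := fun _ _ => rfl
              map_smul' := fun _ _ => rfl } 1
            fun x => (lp.norm_apply_le_norm (by simp) x.1 j).trans_eq (one_mul _).symm
          norm_le_one := LinearMap.mkContinuous_norm_le _ zero_le_one _ }
      naturality := fun _ _ f => HilbOne.Hom.ext <| ContinuousLinearMap.ext fun x =>
        (x.2 f).symm }

/-- The map into the space of bounded compatible families given by a cone. -/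
noncomputable def limitLift (s : Cone F) : s.pt →ₗ[ℝ] boundedThreads F where
  -- Boundedness is automatic: every leg of the cone is a contraction, so `‖x‖` bounds the family.
  toFun x := ⟨⟨fun j => (s.π.app j).hom x, memℓp_infty
    ⟨‖x‖, by rintro _ ⟨j, rfl⟩; exact norm_hom_apply_le _ _⟩⟩, fun _ _ f =>
      DFunLike.congr_fun (congrArg HilbOne.Hom.hom (s.w f)) x⟩
  map_add' x y := Subtype.ext <| lp.ext <| funext fun j => map_add _ x y
  map_smul' r x := Subtype.ext <| lp.ext <| funext fun j => map_smul (s.π.app j).hom r x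

/-- The cone of bounded compatible families is a limit cone. -/
noncomputable def isLimitLimitCone : IsLimit (limitCone F) where
  lift s :=
    { hom := (limitLift F s).mkContinuous 1 fun x =>
        (lp.norm_le_of_forall_le (norm_nonneg x) fun j =>
          norm_hom_apply_le (s.π.app j) x).trans_eq (one_mul _).symm
      norm_le_one := LinearMap.mkContinuous_norm_le _ zero_le_one _ }
  fac _ _ := rfl
  uniq _ _ h := HilbOne.Hom.ext <| ContinuousLinearMap.ext fun x =>
    Subtype.ext <| lp.ext <| funext fun j =>
      DFunLike.congr_fun (congrArg HilbOne.Hom.hom (h j)) x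

end HilbOne

/-! ### Characters of a projective limit of compact abelian groups -/

/-- The hypothesis is approximate multiplicativity of `g / ‖g‖` with denominators cleared: an open
condition that makes sense at zeros of `g`, yet excludes them by strictness. -/
theorem exists_character_near_of_complex {G : Type*} [CommGroup G] [TopologicalSpace G]
    [IsTopologicalGroup G] (g : C(G, ℂ))
    (hg : ∀ x y, ‖(‖g x‖ * ‖g y‖ : ℝ) * g (x * y) - g x * g y * ‖g (x * y)‖‖
      < 1 / 16 * (‖g x‖ * ‖g y‖ * ‖g (x * y)‖)) :
    ∃ χ : G →ₜ* Circle, ∀ x, ‖g x‖ = 1 → ‖(χ x : ℂ) - g x‖ ≤ 3 / 32 := by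
  have h0 : ∀ x, g x ≠ 0 := fun x hx => by
    have := hg x x
    simp [hx] at this
  have h0' : ∀ x, (‖g x‖ : ℂ) ≠ 0 := fun x => by simpa using h0 x
  have hu : ∀ x, g x / ‖g x‖ ∈ Submonoid.unitSphere ℂ := fun x => by
    simp [Submonoid.unitSphere, h0 x]
  let u : C(G, Circle) := ⟨fun x => ⟨g x / ‖g x‖, hu x⟩, Continuous.subtype_mk
    (Continuous.div (by fun_prop) (by fun_prop) h0') _⟩
  have hu' : ∀ x, (u x : ℂ) = g x / ‖g x‖ := fun _ => rfl
  obtain ⟨χ, hχ⟩ := exists_character_near u fun x y => by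
    have e : (u (x * y) : ℂ) - u x * u y =
        ((‖g x‖ * ‖g y‖ : ℝ) * g (x * y) - g x * g y * ‖g (x * y)‖) /
          (‖g x‖ * ‖g y‖ * ‖g (x * y)‖ : ℝ) := by
      have h1 := h0' x
      have h2 := h0' y
      have h3 := h0' (x * y)
      rw [hu', hu', hu']
      push_cast
      field_simp
    have hp : 0 < ‖g x‖ * ‖g y‖ * ‖g (x * y)‖ := by
      have h1 := norm_pos_iff.2 (h0 x)
      have h2 := norm_pos_iff.2 (h0 y)
      have h3 := norm_pos_iff.2 (h0 (x * y))
      positivity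
    rw [e, norm_div, Complex.norm_of_nonneg hp.le, div_le_iff₀ hp]
    exact (hg x y).le
  refine ⟨χ, fun x hx => ?_⟩
  simpa [hu', hx] using hχ x

namespace CompactAbGrp

variable {I : Type v} [Preorder I] {F : Iᵒᵖ ⥤ CompactAbGrp.{max v u}} {c : Cone F}

theorem map_hom_map_hom_apply {i j k : I} (hij : i ≤ j) (hjk : j ≤ k) (x : F.obj (op k)) :
    (F.map (homOfLE hij).op).hom ((F.map (homOfLE hjk).op).hom x) =
      (F.map (homOfLE (hij.trans hjk)).op).hom x :=
  (DFunLike.congr_fun (congrArg CompactAbGrp.Hom.hom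
    (F.map_comp (homOfLE hjk).op (homOfLE hij).op)) x).symm

theorem map_hom_proj_apply (c : Cone F) {i j : I} (hij : i ≤ j) (x : c.pt) :
    (F.map (homOfLE hij).op).hom (proj c (op j) x) = proj c (op i) x :=
  DFunLike.congr_fun (congrArg CompactAbGrp.Hom.hom (c.w (homOfLE hij).op)) x

variable [IsDirectedOrder I]

theorem exists_proj_mem_of_isClosed (hc : IsLimit c) (i : I) {C : Set (F.obj (op i))}
    (hC : IsClosed C)
    (h : ∀ (j : I) (hij : i ≤ j), ∃ x, (F.map (homOfLE hij).op).hom x ∈ C) :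
    ∃ x : c.pt, proj c (op i) x ∈ C := by
  classical
  -- `S j` asks for compatibility only among indices up to `j`; these closed sets decrease, and a
  -- point of their intersection is a compatible family.
  let S : I → Set (∀ k, F.obj k) := fun j => {t | t (op i) ∈ C} ∩
    ⋂ (k : I) (l : I) (hkl : k ≤ l) (_ : l ≤ j),
      {t | (F.map (homOfLE hkl).op).hom (t (op l)) = t (op k)}
  have hS : ∀ j, IsClosed (S j) := fun j =>
    (hC.preimage (f := fun t : ∀ k, F.obj k => t (op i)) (continuous_apply _)).inter <| isClosed_iInter fun k => isClosed_iInter fun l =>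
      isClosed_iInter fun hkl => isClosed_iInter fun _ =>
        isClosed_eq ((map_continuous (F.map (homOfLE hkl).op).hom).comp
          (continuous_apply (op l))) (continuous_apply (op k))
  have hanti : Antitone S := fun a b hab => Set.inter_subset_inter_right _ <|
    Set.iInter_mono fun k => Set.iInter_mono fun l => Set.iInter_mono fun hkl =>
      Set.iInter_mono' fun hl => ⟨hl.trans hab, subset_rfl⟩
  have hne : ∀ j, (S j).Nonempty := fun j => by
    obtain ⟨m, him, hjm⟩ := exists_ge_ge i j
    obtain ⟨x, hx⟩ := h m him
    refine Set.Nonempty.mono (hanti hjm)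
      -- Coordinates not below `m` are unconstrained, so the filler 1 is harmless.
      ⟨fun k => if hk : k.unop ≤ m then (F.map (homOfLE hk).op).hom x else 1, ?_, ?_⟩
    · simpa [him] using hx
    · simp only [Set.mem_iInter]
      intro k l hkl hl
      simp only [Set.mem_ofPred_eq]
      rw [dif_pos hl, dif_pos (hkl.trans hl)]
      exact map_hom_map_hom_apply hkl hl x
  have : Nonempty I := ⟨i⟩
  obtain ⟨t, ht⟩ := IsCompact.nonempty_iInter_of_directed_nonempty_isCompact_isClosed S
    hanti.directed_ge hne (fun j => (hS j).isCompact) hS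
  rw [Set.mem_iInter] at ht
  obtain ⟨x, hx⟩ := exists_forall_π_eq hc (t := t) fun a b f => by
    have := (ht a.unop).2
    simp only [Set.mem_iInter] at this
    exact this b.unop a.unop f.unop.le le_rfl
  exact ⟨x, by rw [hx]; exact (ht i).1⟩

/-- This replaces surjectivity of the projections: the images of later groups shrink to the image of
the limit. -/
theorem exists_map_mem_of_isOpen (hc : IsLimit c) (i : I) {U : Set (F.obj (op i))}
    (hU : IsOpen U) (h : ∀ x : c.pt, proj c (op i) x ∈ U) :
    ∃ (j : I) (hij : i ≤ j), ∀ x, (F.map (homOfLE hij).op).hom x ∈ U := by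
  by_contra! hn
  obtain ⟨x, hx⟩ := exists_proj_mem_of_isClosed hc i hU.isClosed_compl hn
  exact hx (h x)

theorem exists_character_map_eq (hc : IsLimit c) (i : I) (χ η : PontryaginDual (F.obj (op i)))
    (h : ∀ x : c.pt, χ (proj c (op i) x) = η (proj c (op i) x)) :
    ∃ (j : I) (hij : i ≤ j), ∀ x,
      χ ((F.map (homOfLE hij).op).hom x) = η ((F.map (homOfLE hij).op).hom x) := by
  obtain ⟨j, hij, hj⟩ := exists_map_mem_of_isOpen hc i
    (U := {y | ‖(χ y : ℂ) - η y‖ < 1 / 2})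
    (isOpen_lt (by have := map_continuous χ; have := map_continuous η; fun_prop) (by fun_prop))
    fun x => by simp [h x]
  refine ⟨j, hij, fun x => ?_⟩
  exact DFunLike.congr_fun (MonoidHom.eq_of_forall_norm_circle_sub_le
    (f := (χ : F.obj (op i) →* Circle).comp
      ((F.map (homOfLE hij).op).hom : F.obj (op j) →* F.obj (op i)))
    (g := (η : F.obj (op i) →* Circle).comp
      ((F.map (homOfLE hij).op).hom : F.obj (op j) →* F.obj (op i))) fun x => (hj x).le) x

/-- The kernels of the projections decrease to `{1}`, so one of them lies where `χ` is within 1/2 of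
1; being closed under powers, it is killed by `χ`. -/
theorem exists_proj_ker_le_character_ker [Nonempty I] (hc : IsLimit c) (χ : PontryaginDual c.pt) :
    ∃ i : I, ∀ x : c.pt, proj c (op i) x = 1 → χ x = 1 := by
  have hχ := map_continuous χ
  let V : I → Set c.pt := fun i => {x | proj c (op i) x = 1}
  have hV : Antitone V := fun i j hij x (hx : _ = 1) => by
    change _ = 1
    rw [← map_hom_proj_apply c hij, hx, map_one]
  obtain ⟨i, hi⟩ := exists_subset_nhds_of_compactSpace hV.directed_ge
    (fun i => isClosed_eq (map_continuous (proj c (op i))) continuous_const)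
    (U := {x | ‖(χ x : ℂ) - 1‖ < 1 / 2}) fun x hx => by
      have : x = 1 := eq_one_of_forall_π_eq_one hc fun j => Set.mem_iInter.1 hx j.unop
      exact (isOpen_lt (by fun_prop) (by fun_prop)).mem_nhds (by simp [this])
  refine ⟨i, fun x hx => Circle.eq_one_of_forall_norm_pow_two_pow_sub_one_le fun n => ?_⟩
  rw [← map_pow]
  exact (hi (by change _ = 1; rw [map_pow, hx, one_pow])).le

theorem exists_extension_character [Nonempty I] (hc : IsLimit c) (χ : PontryaginDual c.pt) :
    ∃ (i : I) (f : C(F.obj (op i), ℂ)), ∀ x : c.pt, f (proj c (op i) x) = χ x := by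
  have hχ := map_continuous χ
  obtain ⟨i, hi⟩ := exists_proj_ker_le_character_ker hc χ
  have hcont := map_continuous (proj c (op i))
  let q : C(c.pt, Set.range (proj c (op i))) :=
    ⟨Set.rangeFactorization _, hcont.subtype_mk _⟩
  have hq : Topology.IsQuotientMap q :=
    q.continuous.isClosedMap.isQuotientMap q.continuous Set.rangeFactorization_surjective
  let g : C(c.pt, ℂ) := ⟨fun x => χ x, by fun_prop⟩
  have hg : Function.FactorsThrough g q := fun x y hxy => by
    have hxy' : proj c (op i) x = proj c (op i) y := congrArg Subtype.val hxy
    have := hi (x / y) (by rw [map_div, hxy', div_self'])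
    rw [map_div, div_eq_one] at this
    exact congrArg ((↑) : Circle → ℂ) this
  -- Tietze extension from the compact image of `c.pt`.
  obtain ⟨f, hf⟩ := (hq.lift g hg).exists_restrict_eq (isCompact_range hcont).isClosed
  refine ⟨i, f, fun x => ?_⟩
  have h1 := DFunLike.congr_fun hf (q x)
  have h2 := DFunLike.congr_fun (hq.lift_comp g hg) x
  exact h1.trans h2

theorem exists_character_proj_eq [Nonempty I] (hc : IsLimit c) (χ : PontryaginDual c.pt) :
    ∃ (i : I) (η : PontryaginDual (F.obj (op i))), ∀ x : c.pt,
      η (proj c (op i) x) = χ x := by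
  obtain ⟨i, f, hf⟩ := exists_extension_character hc χ
  let W : Set (F.obj (op i) × F.obj (op i)) := {p |
    ‖(‖f p.1‖ * ‖f p.2‖ : ℝ) * f (p.1 * p.2) - f p.1 * f p.2 * ‖f (p.1 * p.2)‖‖
      < 1 / 16 * (‖f p.1‖ * ‖f p.2‖ * ‖f (p.1 * p.2)‖)}
  have hW : IsOpen W := isOpen_lt (by fun_prop) (by fun_prop)
  have hK : IsCompact (Set.range (proj c (op i))) :=
    isCompact_range (map_continuous (proj c (op i)))
  -- On the image of `c.pt` the function `f` is unimodular and multiplicative, so the defect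
  -- vanishes there.
  obtain ⟨U, V, hU, hV, hKU, hKV, hUV⟩ := generalized_tube_lemma hK hK hW (by
    rintro ⟨_, _⟩ ⟨⟨x, rfl⟩, ⟨y, rfl⟩⟩
    simp only [W, Set.mem_ofPred_eq]
    rw [← map_mul, hf, hf, hf]
    simp only [Circle.norm_coe]
    simp)
  obtain ⟨j, hij, hj⟩ := exists_map_mem_of_isOpen hc i (hU.inter hV)
    fun x => ⟨hKU ⟨x, rfl⟩, hKV ⟨x, rfl⟩⟩
  let ψ := (F.map (homOfLE hij).op).hom
  obtain ⟨η, hη⟩ := exists_character_near_of_complex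
    (f.comp ⟨ψ, map_continuous ψ⟩) fun x y => by
      have : (ψ x, ψ y) ∈ W := hUV ⟨(hj x).1, (hj y).2⟩
      simp only [W, Set.mem_ofPred_eq] at this
      rw [← map_mul] at this
      exact this
  refine ⟨j, η, fun x => ?_⟩
  refine DFunLike.congr_fun (MonoidHom.eq_of_forall_norm_circle_sub_le
    (f := (η : F.obj (op j) →* Circle).comp (proj c (op j) : c.pt →* F.obj (op j)))
    (g := (χ : c.pt →* Circle)) fun x => ?_) x
  have e : f (ψ (proj c (op j) x)) = χ x := by
    rw [← hf]
    exact congrArg f (map_hom_proj_apply c hij x)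
  have := hη (proj c (op j) x) (by
    change ‖f (ψ (proj c (op j) x))‖ = 1
    rw [e, Circle.norm_coe])
  change ‖_ - f (ψ (proj c (op j) x))‖ ≤ _ at this
  rw [e] at this
  exact this.trans (by norm_num)

end CompactAbGrp

/-! ### The character group of a projective limit -/

namespace CompactAbGrp

variable {I : Type v} [Preorder I] {F : Iᵒᵖ ⥤ CompactAbGrp.{max v u}} {c : Cone F}

theorem cocone_ι_map (s : Cocone (F.op ⋙ dual)) {i j : I} (hij : i ≤ j)
    (χ : Additive (PontryaginDual (F.obj (op i)))) :
    (s.ι.app (op (op j))).hom (dualHom (F.map (homOfLE hij).op) χ) =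
      (s.ι.app (op (op i))).hom χ :=
  DFunLike.congr_fun (congrArg AddCommGrpCat.Hom.hom (s.w (homOfLE hij).op.op)) χ

variable [IsDirectedOrder I]

theorem cocone_ι_eq_of_dualHom_eq (hc : IsLimit c) (s : Cocone (F.op ⋙ dual)) {i j : I}
    {χ : Additive (PontryaginDual (F.obj (op i)))} {η : Additive (PontryaginDual (F.obj (op j)))}
    (h : dualHom (c.π.app (op i)) χ = dualHom (c.π.app (op j)) η) :
    (s.ι.app (op (op i))).hom χ = (s.ι.app (op (op j))).hom η := by
  obtain ⟨k, hik, hjk⟩ := exists_ge_ge i j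
  rw [← cocone_ι_map s hik, ← cocone_ι_map s hjk]
  obtain ⟨l, hkl, hl⟩ := exists_character_map_eq hc k
    (dualHom (F.map (homOfLE hik).op) χ).toMul (dualHom (F.map (homOfLE hjk).op) η).toMul
    fun x => by
      have h1 := DFunLike.congr_fun (congrArg Additive.toMul h) x
      change χ.toMul ((F.map (homOfLE hik).op).hom (proj c (op k) x)) =
        η.toMul ((F.map (homOfLE hjk).op).hom (proj c (op k) x))
      rw [map_hom_proj_apply, map_hom_proj_apply]
      exact h1
  rw [← cocone_ι_map s hkl, ← cocone_ι_map s hkl]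
  exact congrArg _ (congrArg Additive.ofMul (PontryaginDual.ext hl))

variable [Nonempty I]

theorem exists_dualHom_eq (hc : IsLimit c) (χ : Additive (PontryaginDual c.pt)) :
    ∃ (i : I) (η : Additive (PontryaginDual (F.obj (op i)))),
      dualHom (c.π.app (op i)) η = χ := by
  obtain ⟨i, η, h⟩ := exists_character_proj_eq hc χ.toMul
  exact ⟨i, Additive.ofMul η, congrArg Additive.ofMul (PontryaginDual.ext h)⟩

theorem exists_dualDesc (hc : IsLimit c) (s : Cocone (F.op ⋙ dual)) :
    ∃ φ : Additive (PontryaginDual c.pt) →+ s.pt,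
      ∀ (i : I) η, φ (dualHom (c.π.app (op i)) η) = (s.ι.app (op (op i))).hom η := by
  choose i η h using exists_dualHom_eq hc
  -- The value does not depend on the chosen representative; additivity then follows by moving both
  -- representatives to a common stage.
  have key : ∀ {j : I} (θ : Additive (PontryaginDual (F.obj (op j)))) (χ),
      dualHom (c.π.app (op j)) θ = χ →
        (s.ι.app (op (op (i χ)))).hom (η χ) = (s.ι.app (op (op j))).hom θ :=
    fun θ χ hθ => cocone_ι_eq_of_dualHom_eq hc s ((h χ).trans hθ.symm)
  refine ⟨AddMonoidHom.mk' (fun χ => (s.ι.app (op (op (i χ)))).hom (η χ)) fun χ χ' => ?_,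
    fun j θ => key θ _ rfl⟩
  obtain ⟨k, hk, hk'⟩ := exists_ge_ge (i χ) (i χ')
  have hw : ∀ {j : I} (hjk : j ≤ k) (θ : Additive (PontryaginDual (F.obj (op j)))),
      dualHom (c.π.app (op k)) (dualHom (F.map (homOfLE hjk).op) θ) =
        dualHom (c.π.app (op j)) θ := fun hjk θ =>
    congrArg Additive.ofMul <| PontryaginDual.ext fun x =>
      congrArg θ.toMul (map_hom_proj_apply c hjk x)
  have e := key (dualHom (F.map (homOfLE hk).op) (η χ) +
    dualHom (F.map (homOfLE hk').op) (η χ')) (χ + χ') (by rw [map_add, hw, hw, h, h])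
  rw [e, ← cocone_ι_map s hk (η χ), ← cocone_ι_map s hk' (η χ')]
  exact map_add _ _ _

/-- The character group of a projective limit is the inductive limit of the character groups. -/
theorem nonempty_isColimit_dual_mapCocone (hc : IsLimit c) :
    Nonempty (IsColimit (dual.mapCocone c.op)) := by
  choose φ hφ using fun s => exists_dualDesc hc s
  exact ⟨{
    desc := fun s => AddCommGrpCat.ofHom (φ s)
    fac := fun s j => AddCommGrpCat.hom_ext <| AddMonoidHom.ext fun η => hφ s j.unop.unop η
    uniq := fun s m h => AddCommGrpCat.hom_ext <| AddMonoidHom.ext fun χ => by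
      obtain ⟨i, η, rfl⟩ := exists_dualHom_eq hc χ
      exact (DFunLike.congr_fun (congrArg AddCommGrpCat.Hom.hom (h (op (op i)))) η).trans
        (hφ s i η).symm }⟩

end CompactAbGrp

/-! ### Projective limits of triples -/

namespace LG

variable {I : Type v} [Preorder I] {F : Iᵒᵖ ⥤ LG.{max v u}}
  {cG : Cone (F ⋙ toCompactAbGrp)} {cH : Cone (F ⋙ toHilbOne)}

theorem dualHom_comp_inducedJ (hG : IsLimit cG) (hH : IsLimit cH)
    (hD : IsColimit (CompactAbGrp.dual.mapCocone cG.op)) (s : Cone F) :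
    (HilbOne.dualHom (hH.lift (toHilbOne.mapCone s))).comp (inducedJ F cG cH hD) =
      s.pt.J.comp (CompactAbGrp.dualHom (hG.lift (toCompactAbGrp.mapCone s))) := by
  -- It suffices to compare on characters coming from each stage, where the equation is the
  -- compatibility of a leg of `s`.
  refine congrArg AddCommGrpCat.Hom.hom (hD.hom_ext
    (f := AddCommGrpCat.ofHom ((HilbOne.dualHom (hH.lift (toHilbOne.mapCone s))).comp
      (inducedJ F cG cH hD)))
    (f' := AddCommGrpCat.ofHom (s.pt.J.comp
      (CompactAbGrp.dualHom (hG.lift (toCompactAbGrp.mapCone s))))) fun j => ?_)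
  refine AddCommGrpCat.hom_ext <| AddMonoidHom.ext fun η => ?_
  have h1 := DFunLike.congr_fun
    (congrArg AddCommGrpCat.Hom.hom (hD.fac (dualCocone F cH) j)) η
  have h2 := DFunLike.congr_fun (s.π.app j.unop).compat η
  have h3 := hH.fac (toHilbOne.mapCone s) j.unop
  have h4 := hG.fac (toCompactAbGrp.mapCone s) j.unop
  refine (congrArg (HilbOne.dualHom (hH.lift (toHilbOne.mapCone s))) h1).trans ?_
  refine Eq.trans ?_ (h2.trans ?_)
  · exact congrArg (fun f => HilbOne.dualHom f ((F.obj j.unop).J η)) h3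
  · exact congrArg (fun f => s.pt.J (CompactAbGrp.dualHom f η)) h4.symm

/-- The cone of triples induced by limit cones is a limit cone. -/
noncomputable def isLimitInducedCone (hG : IsLimit cG) (hH : IsLimit cH)
    (hD : IsColimit (CompactAbGrp.dual.mapCocone cG.op)) :
    IsLimit (inducedCone F cG cH hD) where
  lift s := ⟨hG.lift (toCompactAbGrp.mapCone s), hH.lift (toHilbOne.mapCone s),
    dualHom_comp_inducedJ hG hH hD s⟩
  fac s j := LG.Hom.ext (hG.fac (toCompactAbGrp.mapCone s) j) (hH.fac (toHilbOne.mapCone s) j)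
  uniq s m h := LG.Hom.ext
    (hG.uniq (toCompactAbGrp.mapCone s) m.Ψ fun j => congrArg LG.Hom.Ψ (h j))
    (hH.uniq (toHilbOne.mapCone s) m.Φ fun j => congrArg LG.Hom.Φ (h j))

end LG

theorem mainTheorem6 (I : Type v) [Preorder I] [IsDirectedOrder I] [Nonempty I] :
    HasLimitsOfShape Iᵒᵖ LG.{max v u} ∧
    ∀ F : Iᵒᵖ ⥤ LG.{max v u},
      (∃ cG : Cone (F ⋙ LG.toCompactAbGrp),
        Nonempty (IsLimit (CompactAbGrp.toCompactGrp.mapCone cG))) ∧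
      HasLimit (F ⋙ LG.toHilbOne) ∧
      ∀ (cG : Cone (F ⋙ LG.toCompactAbGrp)) (cH : Cone (F ⋙ LG.toHilbOne)),
        IsLimit (CompactAbGrp.toCompactGrp.mapCone cG) → IsLimit cH →
        Nonempty (IsColimit (CompactAbGrp.dual.mapCocone cG.op)) ∧
        ∀ hD : IsColimit (CompactAbGrp.dual.mapCocone cG.op),
          Nonempty (IsLimit (LG.inducedCone F cG cH hD)) := by
  refine ⟨⟨fun F => ?_⟩, fun F => ⟨⟨_, ⟨CompactAbGrp.isLimitMapConeLimitCone _⟩⟩,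
    ⟨⟨⟨_, HilbOne.isLimitLimitCone _⟩⟩⟩, fun cG cH hG' hH => ?_⟩⟩
  · have hG := CompactAbGrp.isLimitLimitCone (F ⋙ LG.toCompactAbGrp)
    obtain ⟨hD⟩ := CompactAbGrp.nonempty_isColimit_dual_mapCocone hG
    exact ⟨⟨⟨_, LG.isLimitInducedCone hG (HilbOne.isLimitLimitCone _) hD⟩⟩⟩
  -- The inclusion into all compact groups is fully faithful, hence reflects limits.
  · have hG : IsLimit cG := isLimitOfReflects CompactAbGrp.toCompactGrp hG'
    exact ⟨CompactAbGrp.nonempty_isColimit_dual_mapCocone hG,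
      fun hD => ⟨LG.isLimitInducedCone hG hH hD⟩⟩
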